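/- Let $\boldsymbol a=(a_0,a_1,a_2,\dots)$ be a sequence of natural numbers with $a_j>1$ for all $j$. Let $\Delta_{\boldsymbol a}$ be the topological group of $\boldsymbol a$-adic integers (the product $\prod_{n\ge 0}\{0,1,\dots,a_n-1\}$ with the product topology and addition with carry), let $u=(1,0,0,\dots)\in\Delta_{\boldsymbol a}$, and let $$\Sigma_{\boldsymbol a}=(\mathbb R\times\Delta_{\boldsymbol a})/\{(n,nu):n\in\mathbb Z\}$$ be the $\boldsymbol a$-adic solenoid. The characteristic function of a probability distribution $\mu$ on the Borel sets of $\Sigma_{\boldsymbol a}$ is $\hat\mu(y)=\int_{\Sigma_{\boldsymbol a}}y(x)\,d\mu(x)$, where $y$ runs over the continuous homomorphisms from $\Sigma_{\boldsymbol a}$ to the group of complex numbers of modulus $1$. The distribution $\mu$ is symmetric if $\mu(B)=\mu(-B)$ for every Borel set $B$. A probability distribution $M$ on $\mathbb R$ is a hyperbolic secant distribution if, for some real $\sigma$ (the value $\sigma=0$ being allowed), $\int_{\mathbb R}e^{isx}\,dM(x)=\dfrac{2}{e^{\sigma s}+e^{-\sigma s}}$ for all $s\in\mathbb R$. Assume that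 $\Sigma_{\boldsymbol a}$ contains an element of order $2$. Let $\alpha$ be a random variable with a Bernoulli distribution taking the values $0$ and $1$ with probability $\frac12$ each. Then, after extending the probability space of $\alpha$ if necessary, there are independent identically distributed random variables $\xi_1,\xi_2,\xi_3$ with values in $\Sigma_{\boldsymbol a}$ and with a symmetric distribution $\mu$ with nowhere vanishing characteristic function, such that $\alpha$ is independent of the random vector $(\xi_1,\xi_2,\xi_3)$ and the linear forms $2\xi_1$ and $\xi_1+\xi_2+2\alpha\xi_3$ are identically distributed, whereas $\mu$ is not of the form $\mu=\tau(M)$ (the image of $M$ under $\tau$) with $\tau:\mathbb R\to\Sigma_{\boldsymbol a}$ a continuous injective homomorphism and $M$ a hyperbolic secant distribution on $\mathbb R$. -/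

import Mathlib

open MeasureTheory ProbabilityTheory

universe u

/-- The group of `a`-adic integers. As a set it is the product of the digit sets
`{0, 1, …, a n - 1}`; addition (below) is digitwise addition with carry. -/
def AdicIntegers (a : ℕ → ℕ) : Type := (n : ℕ) → Fin (a n)

namespace AdicIntegers

variable {a : ℕ → ℕ}

/-- The product topology, each digit set being discrete. -/
instance : TopologicalSpace (AdicIntegers a) :=
  inferInstanceAs (TopologicalSpace ((n : ℕ) → Fin (a n)))

/-- The carry into position `n` when `x` and `y` are added. -/
def carry (x y : AdicIntegers a) : ℕ → ℕ
  | 0 => 0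
  | n + 1 => ((x n : ℕ) + (y n : ℕ) + carry x y n) / a n

/-- `a 0 * a 1 * ⋯ * a (n - 1)`, the weight of the digit at position `n`. -/
def weight (a : ℕ → ℕ) (n : ℕ) : ℕ := ∏ i ∈ Finset.range n, a i

/-- The number given by the first `n` digits of `x`. -/
def val (x : AdicIntegers a) (n : ℕ) : ℕ := ∑ i ∈ Finset.range n, (x i : ℕ) * weight a i

theorem val_lt [∀ n, (a n).AtLeastTwo] (x : AdicIntegers a) (n : ℕ) :
    val x n < weight a n := by
  induction n with
  | zero => simp [val, weight]
  | succ n ih =>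
    have h := (x n).isLt
    have h1 : ((x n : ℕ) + 1) * weight a n ≤ a n * weight a n := Nat.mul_le_mul_right _ h
    have h2 : val x (n + 1) = val x n + (x n : ℕ) * weight a n := by
      simp [val, Finset.sum_range_succ]
    have h3 : weight a (n + 1) = a n * weight a n := by
      simp [weight, Finset.prod_range_succ, mul_comm]
    rw [h2, h3]
    linarith

/-- Two `a`-adic integers are equal if their first `n` digits give the same residue modulo
`weight a n`, for all `n`. -/
theorem ext_val [∀ n, (a n).AtLeastTwo] {x y : AdicIntegers a}
    (h : ∀ n, (val x n : ZMod (weight a n)) = (val y n : ZMod (weight a n))) : x = y := by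
  have h' : ∀ n, val x n = val y n := fun n =>
    Nat.ModEq.eq_of_lt_of_lt ((ZMod.natCast_eq_natCast_iff _ _ _).1 (h n)) (val_lt x n) (val_lt y n)
  funext n
  have hw : 0 < weight a n := (Nat.zero_le _).trans_lt (val_lt x n)
  have h1 := h' (n + 1)
  simp only [val, Finset.sum_range_succ] at h1
  have h2 := h' n
  simp only [val] at h2
  rw [h2] at h1
  exact Fin.ext (Nat.eq_of_mul_eq_mul_right hw (Nat.add_left_cancel h1))

/-- The digitwise complement: the digit `x n` is replaced by `a n - 1 - x n`. -/
def compl (x : AdicIntegers a) : AdicIntegers a := fun n => Fin.rev (x n)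

theorem val_compl_add (x : AdicIntegers a) (n : ℕ) :
    val (compl x) n + val x n + 1 = weight a n := by
  induction n with
  | zero => simp [val, weight]
  | succ n ih =>
    have h2 : ∀ z : AdicIntegers a, val z (n + 1) = val z n + (z n : ℕ) * weight a n := by
      intro z
      simp [val, Finset.sum_range_succ]
    have h3 : weight a (n + 1) = a n * weight a n := by
      simp [weight, Finset.prod_range_succ, mul_comm]
    have h4 : ((compl x n : Fin (a n)) : ℕ) + (x n : ℕ) + 1 = a n := by
      have h := (x n).isLt
      simp only [compl, Fin.val_rev]
      omega
    rw [h2, h2, h3]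
    linear_combination ih + weight a n * h4

variable [∀ n, (a n).AtLeastTwo]

/-- The zero element `(0, 0, 0, …)`. -/
instance : Zero (AdicIntegers a) := ⟨fun _ => 0⟩

/-- Addition with carry. -/
instance : Add (AdicIntegers a) :=
  ⟨fun x y n => Fin.ofNat (a n) ((x n : ℕ) + (y n : ℕ) + carry x y n)⟩

/-- The element `u = (1, 0, 0, …)`. -/
def unit (a : ℕ → ℕ) [∀ n, (a n).AtLeastTwo] : AdicIntegers a := fun n => if n = 0 then 1 else 0

/-- Negation: the digitwise complement plus `(1, 0, 0, …)`. -/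
instance : Neg (AdicIntegers a) := ⟨fun x => compl x + unit a⟩

theorem val_add_carry (x y : AdicIntegers a) (n : ℕ) :
    val (x + y) n + carry x y n * weight a n = val x n + val y n := by
  induction n with
  | zero => simp [val, carry]
  | succ n ih =>
    have h2 : ∀ z : AdicIntegers a, val z (n + 1) = val z n + (z n : ℕ) * weight a n := by
      intro z
      simp [val, Finset.sum_range_succ]
    have h3 : weight a (n + 1) = a n * weight a n := by
      simp [weight, Finset.prod_range_succ, mul_comm]
    have h4 : (((x + y) n : Fin (a n)) : ℕ) = ((x n : ℕ) + (y n : ℕ) + carry x y n) % a n := rfl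
    have h5 : carry x y (n + 1) = ((x n : ℕ) + (y n : ℕ) + carry x y n) / a n := rfl
    have h6 := Nat.mod_add_div ((x n : ℕ) + (y n : ℕ) + carry x y n) (a n)
    rw [h2, h2, h2, h3, h4, h5]
    linear_combination ih + weight a n * h6

theorem cast_val_add (x y : AdicIntegers a) (n : ℕ) :
    (val (x + y) n : ZMod (weight a n)) = val x n + val y n := by
  have h := congrArg (Nat.cast : ℕ → ZMod (weight a n)) (val_add_carry x y n)
  simpa using h

theorem cast_val_zero (n : ℕ) : (val (0 : AdicIntegers a) n : ZMod (weight a n)) = 0 := by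
  have h : ∀ i, (((0 : AdicIntegers a) i : Fin (a i)) : ℕ) = 0 := fun i => rfl
  simp [val, h]

theorem cast_val_unit (n : ℕ) : (val (unit a) n : ZMod (weight a n)) = 1 := by
  cases n with
  | zero => exact Subsingleton.elim (α := ZMod 1) _ _
  | succ n =>
    have h0 : ((unit a 0 : Fin (a 0)) : ℕ) = 1 := by
      have h2 : 2 ≤ a 0 := Nat.AtLeastTwo.prop
      simp only [unit, if_true]
      exact Nat.mod_eq_of_lt h2
    have h : ∀ i, ((unit a (i + 1) : Fin (a (i + 1))) : ℕ) = 0 := fun i => by simp [unit]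
    have h1 : val (unit a) (n + 1) = 1 := by
      simp only [val, Finset.sum_range_succ', h0, h, weight]
      simp
    rw [h1, Nat.cast_one]

theorem cast_val_neg (x : AdicIntegers a) (n : ℕ) :
    (val (-x) n : ZMod (weight a n)) = -val x n := by
  have h := congrArg (Nat.cast : ℕ → ZMod (weight a n)) (val_compl_add x n)
  push_cast at h
  rw [ZMod.natCast_self] at h
  have h1 : (val (-x) n : ZMod (weight a n)) = val (compl x) n + val (unit a) n :=
    cast_val_add (compl x) (unit a) n
  rw [h1, cast_val_unit]
  linear_combination h

instance : AddCommGroup (AdicIntegers a) :=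
  { AddGroup.ofLeftAxioms (G := AdicIntegers a)
      (fun x y z => ext_val fun n => by simp only [cast_val_add, add_assoc])
      (fun x => ext_val fun n => by simp only [cast_val_add, cast_val_zero, zero_add])
      (fun x => ext_val fun n => by
        simp only [cast_val_add, cast_val_zero, cast_val_neg, neg_add_cancel]) with
    add_comm := fun x y => ext_val fun n => by simp only [cast_val_add, add_comm] }

end AdicIntegers

/-- The `a`-adic solenoid `(ℝ × Δ_a) / B`, where `Δ_a` is the group of `a`-adic integers and
`B = {(n, n u) : n ∈ ℤ}` is the subgroup generated by `(1, u)`, `u = (1, 0, 0, …)`. -/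
def Solenoid (a : ℕ → ℕ) [∀ n, (a n).AtLeastTwo] : Type :=
  (ℝ × AdicIntegers a) ⧸ AddSubgroup.zmultiples ((1 : ℝ), AdicIntegers.unit a)

namespace Solenoid

variable (a : ℕ → ℕ) [∀ n, (a n).AtLeastTwo]

instance : AddCommGroup (Solenoid a) :=
  inferInstanceAs (AddCommGroup
    ((ℝ × AdicIntegers a) ⧸ AddSubgroup.zmultiples ((1 : ℝ), AdicIntegers.unit a)))

/-- The quotient topology of the product topology on `ℝ × Δ_a`. -/
instance : TopologicalSpace (Solenoid a) :=
  inferInstanceAs (TopologicalSpace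
    ((ℝ × AdicIntegers a) ⧸ AddSubgroup.zmultiples ((1 : ℝ), AdicIntegers.unit a)))

/-- The Borel `σ`-algebra. -/
instance : MeasurableSpace (Solenoid a) := borel (Solenoid a)

instance : BorelSpace (Solenoid a) := ⟨rfl⟩

end Solenoid

/-- The characteristic function (Fourier transform) of a distribution on an additive group, at a
character `y` of the group: `∫ (x, y) dμ(x)`. -/
noncomputable def groupCharFun {X : Type*} [AddCommGroup X] [MeasurableSpace X]
    (μ : Measure X) (y : AddChar X Circle) : ℂ :=
  ∫ x, (y x : ℂ) ∂μ

/-- `M` is a hyperbolic secant distribution on the real line: a probability distribution with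
characteristic function `2 / (e ^ (σ s) + e ^ (-σ s))` for some real `σ`. The value `σ = 0`, that
is, the unit mass at `0`, is allowed. -/
def IsHyperbolicSecant (M : Measure ℝ) : Prop :=
  IsProbabilityMeasure M ∧
    ∃ σ : ℝ, ∀ s : ℝ, charFun M s = ((2 / (Real.exp (σ * s) + Real.exp (-(σ * s))) : ℝ) : ℂ)

/-!
Let `g` be an element of order `2` and let `μ` be the law of `g + τ(η)`, where `τ` is a
one-parameter subgroup and `η` has a hyperbolic secant distribution. Since `2g = 0`, the shift `g`
cancels both in `2ξ₁` and in `ξ₁ + ξ₂ + 2αξ₃`, so the two forms are identically distributed as soon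
as the characteristic function `φ(t) = 1 / cosh(σt)` of `η` satisfies
`φ(2t) = φ(t)² (1/2 + φ(2t)/2)`, which is the duplication formula for `cosh`. The characteristic
function of `μ` at a character `y` is `y(g)` times a positive number, whereas that of any `τ'(M')`
with `M'` hyperbolic secant is positive; a character with `y(g) ≠ 1` therefore tells them apart.
-/

universe v w

namespace AdicIntegers

variable {a : ℕ → ℕ}

theorem continuous_digit (n : ℕ) : Continuous fun x : AdicIntegers a => x n :=
  continuous_apply (A := fun n => Fin (a n)) n

theorem continuous_val (n : ℕ) : Continuous fun x : AdicIntegers a => val x n :=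
  continuous_finsetSum _ fun i _ =>
    (continuous_of_discreteTopology (f := fun d : Fin (a i) => (d : ℕ) * weight a i)).comp
      (continuous_digit i)

theorem continuous_compl : Continuous (compl : AdicIntegers a → AdicIntegers a) :=
  continuous_pi fun n => (continuous_of_discreteTopology (f := Fin.rev)).comp (continuous_digit n)

theorem continuous_carry (n : ℕ) :
    Continuous fun p : AdicIntegers a × AdicIntegers a => carry p.1 p.2 n := by
  induction n with
  | zero => exact continuous_const
  | succ n ih =>
    exact (continuous_of_discreteTopology
      (f := fun q : Fin (a n) × Fin (a n) × ℕ => ((q.1 : ℕ) + (q.2.1 : ℕ) + q.2.2) / a n)).comp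
      (((continuous_digit n).comp continuous_fst).prodMk
        (((continuous_digit n).comp continuous_snd).prodMk ih))

variable [∀ n, (a n).AtLeastTwo]

instance : ContinuousAdd (AdicIntegers a) where
  continuous_add := continuous_pi fun n =>
    (continuous_of_discreteTopology
      (f := fun q : Fin (a n) × Fin (a n) × ℕ =>
        Fin.ofNat (a n) ((q.1 : ℕ) + (q.2.1 : ℕ) + q.2.2))).comp
      (((continuous_digit n).comp continuous_fst).prodMk
        (((continuous_digit n).comp continuous_snd).prodMk (continuous_carry n)))

instance : IsTopologicalAddGroup (AdicIntegers a) where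
  continuous_neg := continuous_compl.add continuous_const

instance (n : ℕ) : NeZero (weight a n) := ⟨(val_lt (0 : AdicIntegers a) n).ne_bot⟩

/-- Reduction of an `a`-adic integer modulo `weight a n = a 0 * ⋯ * a (n - 1)`. -/
def toZMod (n : ℕ) : AdicIntegers a →+ ZMod (weight a n) where
  toFun x := val x n
  map_zero' := cast_val_zero n
  map_add' x y := cast_val_add x y n

theorem toZMod_unit (n : ℕ) : toZMod n (unit a) = 1 := cast_val_unit n

theorem continuous_toZMod (n : ℕ) : Continuous (toZMod (a := a) n) :=
  (continuous_of_discreteTopology (f := fun k : ℕ => (k : ZMod (weight a n)))).comp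
    (continuous_val n)

theorem eq_zero_of_forall_toZMod_eq_zero {x : AdicIntegers a} (h : ∀ n, toZMod n x = 0) : x = 0 :=
  ext_val fun n => (h n).trans (map_zero (toZMod n)).symm

end AdicIntegers

namespace Solenoid

open AdicIntegers

variable {a : ℕ → ℕ} [∀ n, (a n).AtLeastTwo]

instance : IsTopologicalAddGroup (Solenoid a) :=
  inferInstanceAs (IsTopologicalAddGroup
    ((ℝ × AdicIntegers a) ⧸ AddSubgroup.zmultiples ((1 : ℝ), AdicIntegers.unit a)))

/-- The homomorphism `(t, x) ↦ (t - x) / weight a n` from `ℝ × Δ_a` to `ℝ / ℤ`; it is well defined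
because `x` is known modulo `weight a n`. -/
noncomputable def subDivWeight (n : ℕ) : ℝ × AdicIntegers a →+ UnitAddCircle where
  toFun p := ((p.1 / weight a n : ℝ) : UnitAddCircle) - ZMod.toAddCircle (toZMod n p.2)
  map_zero' := by simp
  map_add' p q := by
    simp only [Prod.fst_add, Prod.snd_add, add_div, AddCircle.coe_add, map_add]
    abel

theorem subDivWeight_apply (n : ℕ) (t : ℝ) (x : AdicIntegers a) :
    subDivWeight n (t, x) =
      ((t / weight a n : ℝ) : UnitAddCircle) - ZMod.toAddCircle (toZMod n x) :=
  rfl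

theorem continuous_subDivWeight (n : ℕ) : Continuous (subDivWeight (a := a) n) :=
  ((AddCircle.continuous_mk' 1).comp (continuous_fst.div_const (weight a n : ℝ))).sub
    ((continuous_of_discreteTopology
      (f := (ZMod.toAddCircle : ZMod (weight a n) → UnitAddCircle))).comp
      ((continuous_toZMod n).comp continuous_snd))

theorem subDivWeight_one_unit (n : ℕ) : subDivWeight n ((1 : ℝ), AdicIntegers.unit a) = 0 := by
  have h := ZMod.toAddCircle_natCast (N := weight a n) 1
  rw [Nat.cast_one, Nat.cast_one] at h
  rw [subDivWeight_apply, toZMod_unit, h, sub_self]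

/-- The homomorphism from the solenoid to `ℝ / ℤ` induced by `subDivWeight n`. -/
noncomputable def toUnitAddCircle (n : ℕ) : Solenoid a →+ UnitAddCircle :=
  QuotientAddGroup.lift (AddSubgroup.zmultiples ((1 : ℝ), AdicIntegers.unit a)) (subDivWeight n)
    (AddSubgroup.zmultiples_le.2 (subDivWeight_one_unit n))

theorem continuous_toUnitAddCircle (n : ℕ) : Continuous (toUnitAddCircle (a := a) n) :=
  (continuous_subDivWeight n).quotient_lift _

theorem mem_zmultiples_of_forall_subDivWeight_eq_zero {p : ℝ × AdicIntegers a}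
    (h : ∀ n, subDivWeight n p = 0) :
    p ∈ AddSubgroup.zmultiples ((1 : ℝ), AdicIntegers.unit a) := by
  obtain ⟨t, x⟩ := p
  obtain ⟨m, rfl⟩ : ∃ m : ℤ, (m : ℝ) = t := by
    have h0 : toZMod 0 x = 0 := Subsingleton.elim (α := ZMod 1) _ _
    have ht : ((t / weight a 0 : ℝ) : UnitAddCircle) = 0 := by
      simpa [subDivWeight_apply, h0] using h 0
    simpa [weight] using (AddCircle.coe_eq_zero_iff 1).1 ht
  have hx : x - m • AdicIntegers.unit a = 0 := eq_zero_of_forall_toZMod_eq_zero fun n => by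
    have hn : subDivWeight n ((0 : ℝ), x - m • AdicIntegers.unit a) = 0 := by
      have := (subDivWeight n).map_sub ((m : ℝ), x) (m • ((1 : ℝ), AdicIntegers.unit a))
      rw [map_zsmul, subDivWeight_one_unit, h, smul_zero, sub_zero] at this
      simpa using this
    simpa only [subDivWeight_apply, zero_div, AddCircle.coe_zero, zero_sub, neg_eq_zero,
      ZMod.toAddCircle_eq_zero] using hn
  exact AddSubgroup.mem_zmultiples_iff.2 ⟨m, Prod.ext (by simp) (sub_eq_zero.1 hx).symm⟩

theorem eq_zero_of_forall_toUnitAddCircle_eq_zero {x : Solenoid a}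
    (h : ∀ n, toUnitAddCircle n x = 0) : x = 0 := by
  induction x using QuotientAddGroup.induction_on with
  | H p =>
    exact (QuotientAddGroup.eq_zero_iff p).2 (mem_zmultiples_of_forall_subDivWeight_eq_zero h)

theorem exists_continuous_addChar_ne_one {x : Solenoid a} (hx : x ≠ 0) :
    ∃ y : AddChar (Solenoid a) Circle, Continuous y ∧ y x ≠ 1 := by
  obtain ⟨n, hn⟩ : ∃ n, toUnitAddCircle n x ≠ 0 := by
    by_contra! h
    exact hx (eq_zero_of_forall_toUnitAddCircle_eq_zero h)
  refine ⟨AddCircle.toCircle_addChar.compAddMonoidHom (toUnitAddCircle n),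
    AddCircle.continuous_toCircle.comp (continuous_toUnitAddCircle n), fun h => hn ?_⟩
  exact AddCircle.injective_toCircle one_ne_zero (h.trans AddCircle.toCircle_zero.symm)

variable (a) in
/-- The canonical one-parameter subgroup `t ↦ [(t, 0)]` of the solenoid. -/
def ofReal : ℝ →+ Solenoid a :=
  (QuotientAddGroup.mk' (AddSubgroup.zmultiples ((1 : ℝ), AdicIntegers.unit a))).comp
    (AddMonoidHom.inl ℝ (AdicIntegers a))

theorem continuous_ofReal : Continuous (ofReal a) :=
  continuous_quot_mk.comp (continuous_id.prodMk continuous_const)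

end Solenoid

theorem exists_eq_circleExp_of_continuous {ψ : AddChar ℝ Circle} (hψ : Continuous ψ) :
    ∃ r : ℝ, ∀ s : ℝ, ψ s = Circle.exp (r * s) := by
  obtain ⟨θ, ⟨hθ_zero, hθ_lift⟩, -⟩ := Circle.isCoveringMap_exp.existsUnique_continuousMap_lifts
    (⟨ψ, hψ⟩ : C(ℝ, Circle)) 0 0 (by simp)
  have hθ_exp : ∀ s, Circle.exp (θ s) = ψ s := fun s => congrFun hθ_lift s
  have hθ_add : ∀ s t, θ (s + t) = θ s + θ t := fun s t => by
    refine congrFun (Circle.isCoveringMap_exp.eq_of_comp_eq (g₁ := fun s => θ (s + t))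
      (g₂ := fun s => θ s + θ t) (by fun_prop) (by fun_prop) ?_ 0 (by simp [hθ_zero])) s
    funext x
    simp [Circle.exp_add, hθ_exp, AddChar.map_add_eq_mul]
  refine ⟨θ 1, fun s => ?_⟩
  have h := map_real_smul (AddMonoidHom.mk' θ hθ_add) θ.continuous s 1
  simp only [AddMonoidHom.mk'_apply, smul_eq_mul, mul_one] at h
  rw [← hθ_exp, h, mul_comm]

section CharacteristicFunction

variable {Ω E F : Type*} [MeasurableSpace Ω] [MeasurableSpace E] [MeasurableSpace F]

theorem isNegInvariant_of_charFun_neg [NormedAddCommGroup E] [InnerProductSpace ℝ E]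
    [CompleteSpace E] [SecondCountableTopology E] [BorelSpace E] {M : Measure E} [IsFiniteMeasure M]
    (h : ∀ t, charFun M (-t) = charFun M t) : M.IsNegInvariant := by
  have : IsFiniteMeasure M.neg := Measure.isFiniteMeasure_map M _
  refine ⟨Measure.ext_of_charFun (funext fun t => ?_)⟩
  simpa [Measure.neg_def, Function.comp_def, h] using charFun_map_smul (μ := M) (-1) t

theorem charFun_smul_add_smul [NormedAddCommGroup E] [InnerProductSpace ℝ E]
    [OpensMeasurableSpace E] [SecondCountableTopology E]
    {M N : Measure E} [IsFiniteMeasure M] [IsFiniteMeasure N] {c d : ENNReal} (hc : c ≠ ⊤)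
    (hd : d ≠ ⊤) (t : E) :
    charFun (c • M + d • N) t = c.toReal * charFun M t + d.toReal * charFun N t := by
  have hint : ∀ (N : Measure E) [IsFiniteMeasure N],
      Integrable (fun x => Complex.exp (inner ℝ x t * Complex.I)) N := fun N _ =>
    .of_bound (by fun_prop) 1 (.of_forall fun x => (Complex.norm_exp_ofReal_mul_I _).le)
  simp only [charFun_apply]
  rw [integral_add_measure ((hint M).smul_measure hc) ((hint N).smul_measure hd),
    integral_smul_measure, integral_smul_measure, Complex.real_smul, Complex.real_smul]

variable {P : Measure Ω}

theorem charFun_map_sum_mul_of_iIndepFun {ι : Type*} [Fintype ι] {η : ι → Ω → ℝ}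
    (hη : ∀ i, Measurable (η i)) (hind : iIndepFun η P) (c : ι → ℝ) (t : ℝ) :
    charFun (P.map fun ω => ∑ i, c i * η i ω) t = ∏ i, charFun (P.map (η i)) (c i * t) := by
  have hind_mul : iIndepFun (fun i ω => c i * η i ω) P :=
    hind.comp (fun i s => c i * s) fun i => measurable_const_mul (c i)
  rw [hind_mul.charFun_map_fun_sum_eq_prod fun i => ((hη i).const_mul (c i)).aemeasurable,
    Finset.prod_apply]
  exact Finset.prod_congr rfl fun i _ => charFun_map_mul_comp (hη i).aemeasurable (c i) t

variable [IsProbabilityMeasure P]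

theorem map_eq_smul_dirac_add_smul_dirac {β : Type*} [MeasurableSpace β]
    [MeasurableSingletonClass β] {α : Ω → β} (hα : Measurable α) {x y : β} (hxy : x ≠ y)
    (h : P {ω | α ω = x} + P {ω | α ω = y} = 1) :
    P.map α = P {ω | α ω = x} • Measure.dirac x + P {ω | α ω = y} • Measure.dirac y := by
  refine (Measure.ae_eq_or_eq_iff_map_eq_dirac_add_dirac hα.aemeasurable hxy).1 ?_
  have hx : MeasurableSet {ω | α ω = x} := hα (measurableSet_singleton x)
  have hy : MeasurableSet {ω | α ω = y} := hα (measurableSet_singleton y)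
  have hdisj : Disjoint {ω | α ω = x} {ω | α ω = y} :=
    Set.disjoint_left.2 fun ω hωx hωy => hxy (hωx.symm.trans hωy)
  exact (mem_ae_iff_prob_eq_one (hx.union hy)).2 ((measure_union hdisj hy).trans h)

theorem map_comp_prodMk_of_indepFun_of_map_eq {β : Type*} [MeasurableSpace β] {α : Ω → β}
    (hα : Measurable α) {X : Ω → E} (hX : Measurable X) (hind : IndepFun α X P) {c d : ENNReal}
    {x y : β} (hlaw : P.map α = c • Measure.dirac x + d • Measure.dirac y) {f : β × E → F}
    (hf : Measurable f) :
    P.map (fun ω => f (α ω, X ω)) =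
      c • P.map (fun ω => f (x, X ω)) + d • P.map (fun ω => f (y, X ω)) := by
  have hprod : P.map (fun ω => (α ω, X ω)) =
      c • (P.map X).map (Prod.mk x) + d • (P.map X).map (Prod.mk y) := by
    rw [(indepFun_iff_map_prod_eq_prod_map_map hα.aemeasurable hX.aemeasurable).1 hind, hlaw,
      Measure.add_prod, Measure.prod_smul_left, Measure.prod_smul_left, Measure.dirac_prod,
      Measure.dirac_prod]
  rw [← Function.comp_def f, ← Measure.map_map hf (hα.prodMk hX), hprod, Measure.map_add _ _ hf,
    Measure.map_smul, Measure.map_smul]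
  simp only [Measure.map_map hf measurable_prodMk_left,
    Measure.map_map (hf.comp measurable_prodMk_left) hX]
  rfl

end CharacteristicFunction

theorem exists_measurePreserving_iIndepFun {Ω₀ : Type u} [MeasurableSpace Ω₀] (P₀ : Measure Ω₀)
    [IsProbabilityMeasure P₀] {ι : Type v} [Finite ι] {E : ι → Type w} [∀ i, MeasurableSpace (E i)]
    (M : (i : ι) → Measure (E i)) [∀ i, IsProbabilityMeasure (M i)] :
    ∃ (Ω : Type (max u v w)) (_ : MeasurableSpace Ω) (P : Measure Ω) (π : Ω → Ω₀)
      (η : (i : ι) → Ω → E i),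
      IsProbabilityMeasure P ∧ MeasurePreserving π P P₀ ∧ (∀ i, MeasurePreserving (η i) P (M i)) ∧
        iIndepFun η P ∧ IndepFun π (fun ω i => η i ω) P := by
  have := Fintype.ofFinite ι
  have hη : ∀ i, MeasurePreserving (fun ω : Ω₀ × ((i : ι) → E i) => ω.2 i)
      (P₀.prod (Measure.pi M)) (M i) := fun i =>
    (measurePreserving_eval M i).comp measurePreserving_snd
  refine ⟨Ω₀ × ((i : ι) → E i), inferInstance, P₀.prod (Measure.pi M), Prod.fst, fun i ω => ω.2 i,
    inferInstance, measurePreserving_fst, hη, ?_, indepFun_prod measurable_id measurable_id⟩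
  rw [iIndepFun_iff_map_fun_eq_pi_map fun i => (hη i).measurable.aemeasurable]
  simp only [(hη _).map_eq]
  exact measurePreserving_snd.map_eq

section HyperbolicSecant

theorem two_div_exp_add_exp_neg (x : ℝ) :
    2 / (Real.exp x + Real.exp (-x)) = (Real.cosh x)⁻¹ := by
  rw [Real.cosh_eq, inv_div]

/-- The log-odds `log (x / (1 - x))` of a probability `x`. -/
noncomputable def logit (x : ℝ) : ℝ := Real.log x - Real.log (1 - x)

theorem measurable_logit : Measurable logit := by
  unfold logit
  fun_prop

theorem integral_betaMeasure {E : Type*} [NormedAddCommGroup E] [NormedSpace ℝ E] {p q : ℝ}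
    (hp : 0 < p) (hq : 0 < q) (f : ℝ → E) :
    ∫ x, f x ∂betaMeasure p q =
      ∫ x in Set.Ioo 0 1, ((beta p q)⁻¹ * (x ^ (p - 1) * (1 - x) ^ (q - 1))) • f x := by
  have hpdf : ∀ x, (betaPDF p q x).toReal = (Set.Ioo (0 : ℝ) 1).indicator
      (fun x => (beta p q)⁻¹ * (x ^ (p - 1) * (1 - x) ^ (q - 1))) x := fun x => by
    by_cases hx : x ∈ Set.Ioo (0 : ℝ) 1
    · rw [Set.indicator_of_mem hx, betaPDF,
        ENNReal.toReal_ofReal (betaPDFReal_pos hx.1 hx.2 hp hq).le, betaPDFReal,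
        if_pos ⟨hx.1, hx.2⟩, one_div, mul_assoc]
    · have hzero : betaPDFReal p q x = 0 := if_neg hx
      rw [Set.indicator_of_notMem hx, betaPDF, hzero, ENNReal.ofReal_zero, ENNReal.toReal_zero]
  rw [betaMeasure, integral_withDensity_eq_integral_toReal_smul₀ (by unfold betaPDF; fun_prop)
    (by simp [betaPDF]), ← integral_indicator measurableSet_Ioo]
  simp only [hpdf, ← Set.indicator_smul_left]

theorem rpow_mul_cexp_logit {x : ℝ} (hx : x ∈ Set.Ioo (0 : ℝ) 1) (p q t : ℝ) :
    ((x ^ (p - 1) * (1 - x) ^ (q - 1) : ℝ) : ℂ) * Complex.exp (t * logit x * Complex.I) =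
      (x : ℂ) ^ (p + t * Complex.I - 1) * (1 - (x : ℂ)) ^ (q - t * Complex.I - 1) := by
  have h0 : 0 < x := hx.1
  have h1 : 0 < 1 - x := sub_pos.2 hx.2
  have hcast : 1 - (x : ℂ) = ((1 - x : ℝ) : ℂ) := by push_cast; rfl
  rw [hcast, Complex.cpow_def_of_ne_zero (by exact_mod_cast h0.ne'),
    Complex.cpow_def_of_ne_zero (by exact_mod_cast h1.ne'), ← Complex.ofReal_log h0.le,
    ← Complex.ofReal_log h1.le, Real.rpow_def_of_pos h0, Real.rpow_def_of_pos h1, logit]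
  push_cast
  rw [← Complex.exp_add, ← Complex.exp_add, ← Complex.exp_add]
  ring_nf

theorem charFun_map_logit_betaMeasure {p q : ℝ} (hp : 0 < p) (hq : 0 < q) (t : ℝ) :
    charFun ((betaMeasure p q).map logit) t =
      Complex.betaIntegral (p + t * Complex.I) (q - t * Complex.I) / beta p q := by
  rw [charFun_apply_real, integral_map measurable_logit.aemeasurable (by fun_prop),
    integral_betaMeasure hp hq, Complex.betaIntegral,
    intervalIntegral.integral_of_le zero_le_one, integral_Ioc_eq_integral_Ioo, div_eq_inv_mul,
    ← integral_const_mul]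
  refine setIntegral_congr_fun measurableSet_Ioo fun x hx => ?_
  simp only [← rpow_mul_cexp_logit hx p q t, Complex.real_smul, Complex.ofReal_mul,
    Complex.ofReal_inv, mul_assoc]

theorem betaIntegral_half_add_mul_I (t : ℝ) :
    Complex.betaIntegral ((1 / 2 : ℝ) + t * Complex.I) ((1 / 2 : ℝ) - t * Complex.I) =
      Real.pi / Real.cosh (Real.pi * t) := by
  set s : ℂ := (1 / 2 : ℝ) + t * Complex.I with hs
  have hs_one_sub : ((1 / 2 : ℝ) : ℂ) - t * Complex.I = 1 - s := by rw [hs]; push_cast; ring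
  have hsin : Complex.sin (Real.pi * s) = Real.cosh (Real.pi * t) := by
    have harg : (Real.pi : ℂ) * s = (Real.pi * t) * Complex.I + Real.pi / 2 := by
      rw [hs]; push_cast; ring
    rw [harg, Complex.sin_add_pi_div_two, Complex.cos_mul_I]
    push_cast
    rfl
  rw [hs_one_sub, Complex.betaIntegral_eq_Gamma_mul_div _ _ (by simp [hs]) (by simp [hs]; norm_num),
    add_sub_cancel, Complex.Gamma_one, div_one, Complex.Gamma_mul_Gamma_one_sub, hsin]

theorem beta_half_half : beta (1 / 2) (1 / 2) = Real.pi := by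
  rw [beta, Real.Gamma_one_half_eq, add_halves, Real.Gamma_one, div_one,
    Real.mul_self_sqrt Real.pi_pos.le]

/-- The hyperbolic secant distribution with parameter `σ`, realized as the law of
`(σ / π) * logit X` where `X` has the arcsine distribution `Beta(1/2, 1/2)`. -/
noncomputable def hyperbolicSecantMeasure (σ : ℝ) : Measure ℝ :=
  ((betaMeasure (1 / 2) (1 / 2)).map logit).map (σ / Real.pi * ·)

theorem charFun_hyperbolicSecantMeasure (σ t : ℝ) :
    charFun (hyperbolicSecantMeasure σ) t = ((Real.cosh (σ * t))⁻¹ : ℝ) := by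
  have hpi : Real.pi ≠ 0 := Real.pi_ne_zero
  rw [hyperbolicSecantMeasure, charFun_map_mul,
    charFun_map_logit_betaMeasure one_half_pos one_half_pos, betaIntegral_half_add_mul_I,
    beta_half_half]
  have harg : Real.pi * (σ / Real.pi * t) = σ * t := by field_simp
  rw [harg, div_right_comm, div_self (by exact_mod_cast hpi), one_div, Complex.ofReal_inv]

theorem isHyperbolicSecant_hyperbolicSecantMeasure (σ : ℝ) :
    IsHyperbolicSecant (hyperbolicSecantMeasure σ) := by
  have := isProbabilityMeasureBeta (one_half_pos (α := ℝ)) (one_half_pos (α := ℝ))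
  have := Measure.isProbabilityMeasure_map (μ := betaMeasure (1 / 2) (1 / 2))
    measurable_logit.aemeasurable
  exact ⟨Measure.isProbabilityMeasure_map (by fun_prop), σ, fun t => by
    rw [charFun_hyperbolicSecantMeasure, two_div_exp_add_exp_neg]⟩

end HyperbolicSecant

section LinearForms

variable {Ω : Type*} [MeasurableSpace Ω] {P : Measure Ω} {M : Measure ℝ} {η : Fin 3 → Ω → ℝ}

theorem charFun_map_add_add_nsmul (hη : ∀ i, MeasurePreserving (η i) P M) (hη_ind : iIndepFun η P)
    (k : ℕ) (t : ℝ) :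
    charFun (P.map fun ω => η 0 ω + η 1 ω + k • η 2 ω) t =
      charFun M t ^ 2 * charFun M (k * t) := by
  have h := charFun_map_sum_mul_of_iIndepFun (fun i => (hη i).measurable) hη_ind ![1, 1, (k : ℝ)] t
  simpa [(hη _).map_eq, Fin.sum_univ_three, Fin.prod_univ_three, sq] using h

variable [IsProbabilityMeasure P] {α : Ω → ℕ}

theorem charFun_map_add_add_two_mul_nsmul (hα : Measurable α) (hα_zero : P {ω | α ω = 0} = 1 / 2)
    (hα_one : P {ω | α ω = 1} = 1 / 2) (hη : ∀ i, MeasurePreserving (η i) P M)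
    (hη_ind : iIndepFun η P) (hαη : IndepFun α (fun ω i => η i ω) P) (t : ℝ) :
    charFun (P.map fun ω => η 0 ω + η 1 ω + (2 * α ω) • η 2 ω) t =
      charFun M t ^ 2 * (1 / 2 + 1 / 2 * charFun M (2 * t)) := by
  have hηm : ∀ i, Measurable (η i) := fun i => (hη i).measurable
  have : IsProbabilityMeasure M :=
    (hη 0).map_eq ▸ Measure.isProbabilityMeasure_map (hηm 0).aemeasurable
  have hlaw := map_eq_smul_dirac_add_smul_dirac (P := P) hα zero_ne_one
    (by rw [hα_zero, hα_one, ENNReal.add_halves])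
  rw [hα_zero, hα_one] at hlaw
  let f : ℕ × (Fin 3 → ℝ) → ℝ := fun p => p.2 0 + p.2 1 + (2 * p.1) • p.2 2
  have hf : Measurable f := by
    simp only [f, nsmul_eq_mul]
    fun_prop
  have hmix : P.map (fun ω => η 0 ω + η 1 ω + (2 * α ω) • η 2 ω) =
      (1 / 2 : ENNReal) • P.map (fun ω => η 0 ω + η 1 ω + (2 * 0) • η 2 ω) +
        (1 / 2 : ENNReal) • P.map (fun ω => η 0 ω + η 1 ω + (2 * 1) • η 2 ω) :=
    map_comp_prodMk_of_indepFun_of_map_eq hα (measurable_pi_lambda _ hηm) hαη hlaw hf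
  rw [hmix, charFun_smul_add_smul (by simp) (by simp), charFun_map_add_add_nsmul hη hη_ind,
    charFun_map_add_add_nsmul hη hη_ind]
  simp only [mul_zero, mul_one, Nat.cast_zero, Nat.cast_ofNat, zero_mul, charFun_zero,
    probReal_univ, Complex.ofReal_one, one_div, ENNReal.toReal_inv, ENNReal.toReal_ofNat,
    Complex.ofReal_inv, Complex.ofReal_ofNat]
  ring

theorem identDistrib_two_nsmul_of_charFun_two_mul
    (hM : ∀ t, charFun M (2 * t) = charFun M t ^ 2 * (1 / 2 + 1 / 2 * charFun M (2 * t)))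
    (hα : Measurable α) (hα_zero : P {ω | α ω = 0} = 1 / 2) (hα_one : P {ω | α ω = 1} = 1 / 2)
    (hη : ∀ i, MeasurePreserving (η i) P M) (hη_ind : iIndepFun η P)
    (hαη : IndepFun α (fun ω i => η i ω) P) :
    IdentDistrib (fun ω => 2 • η 0 ω) (fun ω => η 0 ω + η 1 ω + (2 * α ω) • η 2 ω) P P := by
  have hηm : ∀ i, Measurable (η i) := fun i => (hη i).measurable
  have hleft : Measurable fun ω => 2 • η 0 ω := (hηm 0).const_smul 2
  have hright : Measurable fun ω => η 0 ω + η 1 ω + (2 * α ω) • η 2 ω := by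
    simp only [nsmul_eq_mul]
    fun_prop
  have := Measure.isProbabilityMeasure_map (μ := P) hleft.aemeasurable
  have := Measure.isProbabilityMeasure_map (μ := P) hright.aemeasurable
  refine ⟨hleft.aemeasurable, hright.aemeasurable, Measure.ext_of_charFun (funext fun t => ?_)⟩
  have hdouble : charFun (P.map fun ω => 2 • η 0 ω) t = charFun M (2 * t) := by
    simp only [nsmul_eq_mul, Nat.cast_ofNat, ← (hη 0).map_eq]
    exact charFun_map_mul_comp (hηm 0).aemeasurable 2 t
  rw [hdouble, charFun_map_add_add_two_mul_nsmul hα hα_zero hα_one hη hη_ind hαη, ← hM]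

end LinearForms

namespace IsHyperbolicSecant

variable {M : Measure ℝ}

theorem exists_charFun_eq_inv_cosh (hM : IsHyperbolicSecant M) :
    ∃ σ : ℝ, ∀ t : ℝ, charFun M t = ((Real.cosh (σ * t))⁻¹ : ℝ) := by
  obtain ⟨-, σ, hσ⟩ := hM
  exact ⟨σ, fun t => by rw [hσ, two_div_exp_add_exp_neg]⟩

theorem exists_pos_charFun_eq (hM : IsHyperbolicSecant M) (t : ℝ) :
    ∃ c : ℝ, 0 < c ∧ charFun M t = c := by
  obtain ⟨σ, hσ⟩ := hM.exists_charFun_eq_inv_cosh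
  exact ⟨_, inv_pos.2 (Real.cosh_pos _), hσ t⟩

theorem isNegInvariant (hM : IsHyperbolicSecant M) : M.IsNegInvariant := by
  have := hM.1
  obtain ⟨σ, hσ⟩ := hM.exists_charFun_eq_inv_cosh
  exact isNegInvariant_of_charFun_neg fun t => by rw [hσ, hσ, mul_neg, Real.cosh_neg]

theorem charFun_two_mul (hM : IsHyperbolicSecant M) (t : ℝ) :
    charFun M (2 * t) = charFun M t ^ 2 * (1 / 2 + 1 / 2 * charFun M (2 * t)) := by
  obtain ⟨σ, hσ⟩ := hM.exists_charFun_eq_inv_cosh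
  have hcosh : Real.cosh (σ * t) ^ 2 = (1 + Real.cosh (σ * (2 * t))) / 2 := by
    rw [mul_left_comm, Real.cosh_two_mul, Real.sinh_sq]
    ring
  have hreal : (Real.cosh (σ * (2 * t)))⁻¹ =
      (Real.cosh (σ * t))⁻¹ ^ 2 * (1 / 2 + 1 / 2 * (Real.cosh (σ * (2 * t)))⁻¹) := by
    have := Real.cosh_pos (σ * (2 * t))
    rw [inv_pow, hcosh]
    field_simp
    ring
  have hcomplex := congrArg Complex.ofReal hreal
  push_cast at hcomplex
  rw [hσ, hσ]
  push_cast
  exact hcomplex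

end IsHyperbolicSecant

section ShiftedImage

variable {X : Type*} [AddCommGroup X] [MeasurableSpace X]

theorem isNegInvariant_map_const_add [MeasurableAdd X] [MeasurableNeg X] {G : Type*} [AddGroup G]
    [MeasurableSpace G] [MeasurableNeg G] {M : Measure G} [M.IsNegInvariant] {g : X}
    (hg : 2 • g = 0) {τ : G →+ X} (hτ : Measurable τ) :
    (M.map fun s => g + τ s).IsNegInvariant := by
  have hneg : -g = g := neg_eq_of_add_eq_zero_left (by rw [← two_nsmul, hg])
  have hm : Measurable fun s => g + τ s := hτ.const_add g
  refine ⟨?_⟩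
  conv_rhs => rw [← Measure.map_neg_eq_self M, Measure.map_map hm measurable_neg]
  rw [Measure.neg_def, Measure.map_map measurable_neg hm]
  congr 1
  funext s
  simp [hneg, add_comm]

theorem identDistrib_two_nsmul_const_add {G : Type*} [AddCommMonoid G] [MeasurableSpace G] {g : X}
    (hg : 2 • g = 0) {τ : G →+ X} (hτ : Measurable τ) {Ω : Type*} [MeasurableSpace Ω]
    {P : Measure Ω} {α : Ω → ℕ} {η : Fin 3 → Ω → G}
    (h : IdentDistrib (fun ω => 2 • η 0 ω)
      (fun ω => η 0 ω + η 1 ω + (2 * α ω) • η 2 ω) P P) :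
    IdentDistrib (fun ω => 2 • (g + τ (η 0 ω)))
      (fun ω => g + τ (η 0 ω) + (g + τ (η 1 ω)) + (2 * α ω) • (g + τ (η 2 ω))) P P := by
  have hleft : ∀ s, 2 • (g + τ s) = τ (2 • s) := fun s => by
    rw [nsmul_add, hg, zero_add, map_nsmul]
  have hright : ∀ (n : ℕ) (r s t : G),
      g + τ r + (g + τ s) + (2 * n) • (g + τ t) = τ (r + s + (2 * n) • t) := fun n r s t => by
    rw [add_add_add_comm, ← two_nsmul, hg, zero_add, mul_comm 2 n, mul_nsmul', hleft, ← map_nsmul,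
      ← mul_nsmul', ← map_add, ← map_add]
  simp only [hleft, hright]
  exact h.comp hτ

variable [TopologicalSpace X] [IsTopologicalAddGroup X] [BorelSpace X]

theorem exists_forall_groupCharFun_map_eq {τ : ℝ →+ X} (hτ : Continuous τ) {y : AddChar X Circle}
    (hy : Continuous y) :
    ∃ r : ℝ, ∀ (M : Measure ℝ) (g : X),
      groupCharFun (M.map fun s => g + τ s) y = y g * charFun M r := by
  obtain ⟨r, hr⟩ := exists_eq_circleExp_of_continuous (ψ := y.compAddMonoidHom τ) (hy.comp hτ)
  refine ⟨r, fun M g => ?_⟩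
  rw [groupCharFun, integral_map (hτ.const_add g).measurable.aemeasurable
    (Continuous.measurable (by fun_prop)).aestronglyMeasurable, charFun_apply_real,
    ← integral_const_mul]
  refine integral_congr_ae (.of_forall fun s => ?_)
  have hs : y (τ s) = Circle.exp (r * s) := hr s
  simp only [AddChar.map_add_eq_mul, hs, Circle.coe_mul, Circle.coe_exp, Complex.ofReal_mul]

namespace IsHyperbolicSecant

variable {M : Measure ℝ} {g : X} {τ : ℝ →+ X}

theorem groupCharFun_map_ne_zero (hM : IsHyperbolicSecant M) (g : X) (hτ : Continuous τ)
    {y : AddChar X Circle} (hy : Continuous y) : groupCharFun (M.map fun s => g + τ s) y ≠ 0 := by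
  obtain ⟨r, hr⟩ := exists_forall_groupCharFun_map_eq hτ hy
  obtain ⟨c, hc, hMc⟩ := hM.exists_pos_charFun_eq r
  rw [hr, hMc]
  exact mul_ne_zero (Circle.coe_ne_zero _) (by exact_mod_cast hc.ne')

theorem apply_eq_one_of_map_eq_map (hM : IsHyperbolicSecant M) (hτ : Continuous τ) {M' : Measure ℝ}
    (hM' : IsHyperbolicSecant M') {τ' : ℝ →+ X} (hτ' : Continuous τ')
    (h : (M.map fun s => g + τ s) = M'.map τ') {y : AddChar X Circle} (hy : Continuous y) :
    y g = 1 := by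
  obtain ⟨r, hr⟩ := exists_forall_groupCharFun_map_eq hτ hy
  obtain ⟨r', hr'⟩ := exists_forall_groupCharFun_map_eq hτ' hy
  obtain ⟨c, hc, hMc⟩ := hM.exists_pos_charFun_eq r
  obtain ⟨c', hc', hMc'⟩ := hM'.exists_pos_charFun_eq r'
  have hyg : (y g : ℂ) * c = c' := by
    have h' := hr' M' 0
    simp only [zero_add, AddChar.map_zero_eq_one, Circle.coe_one, one_mul] at h'
    rw [← hMc, ← hMc', ← hr, h, h']
  have hcc' : c = c' := by
    have hnorm := congrArg norm hyg
    rwa [norm_mul, Circle.norm_coe, one_mul, Complex.norm_of_nonneg hc.le,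
      Complex.norm_of_nonneg hc'.le] at hnorm
  rw [← hcc'] at hyg
  exact Circle.ext (mul_right_cancel₀ (by exact_mod_cast hc.ne') (hyg.trans (one_mul _).symm))

theorem exists_iIndepFun_identDistrib_two_nsmul (hM : IsHyperbolicSecant M) (hg : 2 • g = 0)
    (hτ : Continuous τ) {Ω₀ : Type u} [MeasurableSpace Ω₀] (P₀ : Measure Ω₀)
    [IsProbabilityMeasure P₀] {α : Ω₀ → ℕ} (hα : Measurable α)
    (hα_zero : P₀ {ω | α ω = 0} = 1 / 2) (hα_one : P₀ {ω | α ω = 1} = 1 / 2) :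
    ∃ (Ω : Type u) (_ : MeasurableSpace Ω) (P : Measure Ω) (π : Ω → Ω₀) (ξ : Fin 3 → Ω → X),
      IsProbabilityMeasure P ∧ MeasurePreserving π P P₀ ∧
      (∀ i, MeasurePreserving (ξ i) P (M.map fun s => g + τ s)) ∧ iIndepFun ξ P ∧
      IndepFun (fun ω => α (π ω)) (fun ω i => ξ i ω) P ∧
      IdentDistrib (fun ω => 2 • ξ 0 ω)
        (fun ω => ξ 0 ω + ξ 1 ω + (2 * α (π ω)) • ξ 2 ω) P P := by
  have := hM.1
  have hm : Measurable fun s => g + τ s := (hτ.const_add g).measurable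
  obtain ⟨Ω, _, P, π, η, hP, hπ, hη, hη_ind, hπη⟩ :=
    exists_measurePreserving_iIndepFun P₀ fun _ : Fin 3 => M
  have hα_eq : ∀ n, P {ω | α (π ω) = n} = P₀ {ω | α ω = n} := fun n =>
    hπ.measure_preimage (hα (measurableSet_singleton n)).nullMeasurableSet
  refine ⟨Ω, _, P, π, fun i ω => g + τ (η i ω), hP, hπ, fun i => ?_,
    hη_ind.comp (fun _ s => g + τ s) fun _ => hm,
    hπη.comp hα (measurable_pi_lambda _ fun i => hm.comp (measurable_pi_apply i)), ?_⟩
  · exact (hm.measurePreserving M).comp (hη i)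
  · exact identDistrib_two_nsmul_const_add hg hτ.measurable
      (identDistrib_two_nsmul_of_charFun_two_mul hM.charFun_two_mul (hα.comp hπ.measurable)
        ((hα_eq 0).trans hα_zero) ((hα_eq 1).trans hα_one) hη hη_ind (hπη.comp hα measurable_id))

end IsHyperbolicSecant

theorem proposition2p7_general {μ : Measure X} {M : Measure ℝ} (hM : IsHyperbolicSecant M) {g : X}
    (hg : 2 • g = 0) {y : AddChar X Circle} (hy : Continuous y) (hyg : y g ≠ 1) {τ : ℝ →+ X}
    (hτ : Continuous τ) (hμ : μ = M.map fun s => g + τ s)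
    {Ω₀ : Type u} [MeasurableSpace Ω₀] (P₀ : Measure Ω₀) [IsProbabilityMeasure P₀]
    {α : Ω₀ → ℕ} (hα : Measurable α)
    (hα_zero : P₀ {ω | α ω = 0} = 1 / 2) (hα_one : P₀ {ω | α ω = 1} = 1 / 2) :
    IsProbabilityMeasure μ ∧
      (∀ B : Set X, MeasurableSet B → μ B = μ ((fun x => -x) ⁻¹' B)) ∧
      (∀ z : AddChar X Circle, Continuous z → groupCharFun μ z ≠ 0) ∧
      (∃ (Ω : Type u) (_ : MeasurableSpace Ω) (P : Measure Ω) (π : Ω → Ω₀) (ξ₁ ξ₂ ξ₃ : Ω → X),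
        IsProbabilityMeasure P ∧ MeasurePreserving π P P₀ ∧
        Measurable ξ₁ ∧ Measurable ξ₂ ∧ Measurable ξ₃ ∧
        P.map ξ₁ = μ ∧ P.map ξ₂ = μ ∧ P.map ξ₃ = μ ∧
        iIndepFun ![ξ₁, ξ₂, ξ₃] P ∧
        IndepFun (fun ω => α (π ω)) (fun ω => (ξ₁ ω, ξ₂ ω, ξ₃ ω)) P ∧
        IdentDistrib (fun ω => 2 • ξ₁ ω)
          (fun ω => ξ₁ ω + ξ₂ ω + (2 * α (π ω)) • ξ₃ ω) P P) ∧
      ¬ ∃ (τ' : ℝ →+ X) (M' : Measure ℝ), Continuous τ' ∧ IsHyperbolicSecant M' ∧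
          μ = M'.map τ' := by
  subst hμ
  have := hM.1
  have := hM.isNegInvariant
  have := isNegInvariant_map_const_add (M := M) hg hτ.measurable
  obtain ⟨Ω, _, P, π, ξ, hP, hπ, hξ, hξ_ind, hαξ, hid⟩ :=
    hM.exists_iIndepFun_identDistrib_two_nsmul hg hτ P₀ hα hα_zero hα_one
  have hξ_vec : ![ξ 0, ξ 1, ξ 2] = ξ := by
    funext i
    fin_cases i <;> rfl
  have htriple : Measurable fun x : Fin 3 → X => (x 0, x 1, x 2) := by fun_prop
  refine ⟨Measure.isProbabilityMeasure_map (hτ.const_add g).measurable.aemeasurable,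
    fun B _ => (Measure.measure_preimage_neg _ B).symm,
    fun z hz => hM.groupCharFun_map_ne_zero g hτ hz,
    ⟨Ω, _, P, π, ξ 0, ξ 1, ξ 2, hP, hπ, (hξ 0).measurable, (hξ 1).measurable, (hξ 2).measurable,
      (hξ 0).map_eq, (hξ 1).map_eq, (hξ 2).map_eq, hξ_vec ▸ hξ_ind,
      hαξ.comp measurable_id htriple, hid⟩, ?_⟩
  rintro ⟨τ', M', hτ', hM', h⟩
  exact hyg (hM.apply_eq_one_of_map_eq_map hτ hM' hτ' h hy)

end ShiftedImage

theorem proposition2p7 (a : ℕ → ℕ) [∀ j, (a j).AtLeastTwo]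
    (h_two : ∃ g : Solenoid a, addOrderOf g = 2)
    {Ω₀ : Type u} [MeasurableSpace Ω₀] (P₀ : Measure Ω₀) [IsProbabilityMeasure P₀]
    (α : Ω₀ → ℕ) (hα : Measurable α)
    (hα_zero : P₀ {ω | α ω = 0} = 1 / 2) (hα_one : P₀ {ω | α ω = 1} = 1 / 2) :
    ∃ (μ : Measure (Solenoid a)),
      IsProbabilityMeasure μ ∧
      -- `μ` is symmetric, with nonvanishing characteristic function
      (∀ B : Set (Solenoid a), MeasurableSet B → μ B = μ ((fun x => -x) ⁻¹' B)) ∧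
      (∀ y : AddChar (Solenoid a) Circle, Continuous y → groupCharFun μ y ≠ 0) ∧
      -- on some extension `π : Ω → Ω₀` of the probability space of `α` there are `ξ₁, ξ₂, ξ₃`
      (∃ (Ω : Type u) (_ : MeasurableSpace Ω) (P : Measure Ω) (π : Ω → Ω₀)
          (ξ₁ ξ₂ ξ₃ : Ω → Solenoid a),
        IsProbabilityMeasure P ∧ MeasurePreserving π P P₀ ∧
        Measurable ξ₁ ∧ Measurable ξ₂ ∧ Measurable ξ₃ ∧
        P.map ξ₁ = μ ∧ P.map ξ₂ = μ ∧ P.map ξ₃ = μ ∧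
        iIndepFun ![ξ₁, ξ₂, ξ₃] P ∧
        IndepFun (fun ω => α (π ω)) (fun ω => (ξ₁ ω, ξ₂ ω, ξ₃ ω)) P ∧
        IdentDistrib (fun ω => 2 • ξ₁ ω)
          (fun ω => ξ₁ ω + ξ₂ ω + (2 * α (π ω)) • ξ₃ ω) P P) ∧
      -- `μ` is not of the form `τ(M)`
      ¬ ∃ (τ : ℝ →+ Solenoid a) (M : Measure ℝ), Continuous τ ∧ Function.Injective τ ∧
          IsHyperbolicSecant M ∧ μ = M.map τ := by
  obtain ⟨g, hg⟩ := h_two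
  have hg_ne : g ≠ 0 := fun h => by simp [h] at hg
  obtain ⟨y, hy, hyg⟩ := Solenoid.exists_continuous_addChar_ne_one hg_ne
  obtain ⟨hprob, hsymm, hchar, hforms, hnot⟩ :=
    proposition2p7_general (isHyperbolicSecant_hyperbolicSecantMeasure 1)
      (hg ▸ addOrderOf_nsmul_eq_zero g) hy hyg Solenoid.continuous_ofReal rfl P₀ hα hα_zero hα_one
  exact ⟨_, hprob, hsymm, hchar, hforms, fun ⟨τ, M, hτ, _, h⟩ => hnot ⟨τ, M, hτ, h⟩⟩
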